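/- **Definitions.** A *gauged measure space* (gm-space) is a triple $\mathbb X=(X,g,\xi)$ of a Polish space $X$, a Borel probability measure $\xi$ on $X$, and a symmetric function $g\colon X\times X\to\mathbb R$ (the gauge) that is square-integrable with respect to $\xi\otimes\xi$. For gm-spaces $\mathbb X=(X,g,\xi)$ and $\mathbb Y=(Y,h,\upsilon)$ put $$\mathrm{GW}(\mathbb X,\mathbb Y)=\inf_{\pi}\Bigl(\iint |g(x,x')-h(y,y')|^2\,d\pi(x,y)\,d\pi(x',y')\Bigr)^{1/2},$$ where $\pi$ ranges over all Borel probability measures on $X\times Y$ with marginals $\xi$ and $\upsilon$. For gm-spaces $\mathbb X_i=(X_i,g_i,\xi_i)$, $i=1,\dots,N$, and $\rho\in\Delta_{N-1}=\{\rho\in[0,1]^N:\sum_i\rho_i=1\}$, let $\Pi(\mathbb X_1,\dots,\mathbb X_N)$ be the set of Borel probability measures on $X_1\times\dots\times X_N$ with marginals $\xi_1,\dots,\xi_N$, and let $\Pi_{\mathrm o}^\rho(\mathbb X_1,\dots,\mathbb X_N)$ be the set of those $\pi\in\Pi(\mathbb X_1,\dots,\mathbb X_N)$ that minimize $$\iint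 \tfrac12\sum_{i,j=1}^N\rho_i\rho_j\,|g_i(x_i,x_i')-g_j(x_j,x_j')|^2\,d\pi(x)\,d\pi(x')$$ over $\Pi(\mathbb X_1,\dots,\mathbb X_N)$. A *GW barycenter* of $\mathbb X_1,\dots,\mathbb X_N$ with weights $\rho$ is a gm-space $\mathbb Y$ that minimizes $\sum_{i=1}^N\rho_i\,\mathrm{GW}(\mathbb X_i,\mathbb Y)^2$ among all gm-spaces. For a square matrix $B$, $B^{(d)}$ denotes its upper left $d\times d$ submatrix. **Theorem 5.2.** Let $N\ge 1$ and $d_1\ge\dots\ge d_N$ be natural numbers. For $i=1,\dots,N$ let $\Sigma_i\in\mathbb R^{d_i\times d_i}$ be symmetric positive definite, let $\xi_i=\mathcal N(0,\Sigma_i)$, and let $\mathbb X_i=(\mathbb R^{d_i},\langle\cdot,\cdot\rangle_{d_i},\xi_i)$, where $\langle\cdot,\cdot\rangle_{d_i}$ is the standard scalar product. Let $\Sigma_i=P_iD_iP_i^{\mathrm T}$ with $P_i$ orthogonal and $D_i$ diagonal with diagonal entries sorted in decreasing (i.e. non-increasing) order. Fix diagonal matrices $\tilde I_i\in\mathbb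 R^{d_i\times d_i}$ with all diagonal entries in $\{-1,1\}$, and define $T_i\colon\mathbb R^{d_1}\to\mathbb R^{d_i}$ by $$T_i(x)=P_iA_iP_1^{\mathrm T}x,\qquad A_i=\Bigl(\tilde I_i\,D_i^{1/2}\bigl(D_1^{(d_i)}\bigr)^{-1/2}\ \Bigm|\ 0_{d_i,\,d_1-d_i}\Bigr)\in\mathbb R^{d_i\times d_1}.$$ Then for every $\rho\in\Delta_{N-1}$: 1. $(T_1,\dots,T_N)_\#\xi_1\in\Pi_{\mathrm o}^\rho(\mathbb X_1,\dots,\mathbb X_N)$; 2. the gm-space $\mathbb Y=(\mathbb R^{d_1},\langle\cdot,\cdot\rangle_{d_1},\hat\upsilon)$ with $$\hat\upsilon=\mathcal N\Bigl(0,\ \sum_{i=1}^N\rho_i\begin{pmatrix}D_i&0\\0&0\end{pmatrix}\Bigr)$$ (blocks of total size $d_1\times d_1$) is a GW barycenter of $\mathbb X_1,\dots,\mathbb X_N$ with weights $\rho$. -/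

import Mathlib

open MeasureTheory ProbabilityTheory
open scoped ENNReal Matrix

universe u v

noncomputable section

/-- A gauged measure space `(X, g, ξ)`: a Polish space `X` with its Borel σ-algebra, a Borel
probability measure `ξ`, and a gauge `g`, that is, a symmetric function on `X × X` which is
square-integrable with respect to `ξ ⊗ ξ`. -/
structure GMSpace : Type (u + 1) where
  carrier : Type u
  [topology : TopologicalSpace carrier]
  [polish : PolishSpace carrier]
  [measurable : MeasurableSpace carrier]
  [borel : BorelSpace carrier]
  measure : Measure carrier
  [prob : IsProbabilityMeasure measure]
  gauge : carrier → carrier → ℝ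
  gauge_symm : ∀ x y, gauge x y = gauge y x
  gauge_memLp : MemLp (fun p : carrier × carrier => gauge p.1 p.2) 2 (measure.prod measure)

attribute [instance] GMSpace.topology GMSpace.polish GMSpace.measurable GMSpace.borel GMSpace.prob

namespace GMSpace

/-- The set of transport plans between two gm-spaces. -/
def plans (X : GMSpace.{u}) (Y : GMSpace.{v}) : Set (Measure (X.carrier × Y.carrier)) :=
  {π | IsProbabilityMeasure π ∧ π.map Prod.fst = X.measure ∧ π.map Prod.snd = Y.measure}

/-- The Gromov–Wasserstein functional: the `L²(π ⊗ π)`-norm of `g(x, x') - h(y, y')`,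
where the variable of integration is `((x, y), (x', y'))`. -/
def gwFunctional (X : GMSpace.{u}) (Y : GMSpace.{v})
    (π : Measure (X.carrier × Y.carrier)) : ℝ≥0∞ :=
  eLpNorm (fun p : (X.carrier × Y.carrier) × (X.carrier × Y.carrier) =>
    X.gauge p.1.1 p.2.1 - Y.gauge p.1.2 p.2.2) 2 (π.prod π)

/-- The Gromov–Wasserstein distance. -/
def GW (X : GMSpace.{u}) (Y : GMSpace.{v}) : ℝ≥0∞ :=
  ⨅ π ∈ plans X Y, gwFunctional X Y π

/-- The set of multi-marginal transport plans between finitely many gm-spaces. -/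
def multiPlans {N : ℕ} (X : Fin N → GMSpace.{u}) : Set (Measure (∀ i, (X i).carrier)) :=
  {π | IsProbabilityMeasure π ∧ ∀ i, π.map (fun x => x i) = (X i).measure}

/-- The multi-marginal Gromov–Wasserstein functional with weights `ρ`. -/
def mgwFunctional {N : ℕ} (ρ : Fin N → ℝ) (X : Fin N → GMSpace.{u})
    (π : Measure (∀ i, (X i).carrier)) : ℝ≥0∞ :=
  ∫⁻ p : (∀ i, (X i).carrier) × (∀ i, (X i).carrier),
    ENNReal.ofReal ((1 / 2) * ∑ i, ∑ j, ρ i * ρ j *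
      |(X i).gauge (p.1 i) (p.2 i) - (X j).gauge (p.1 j) (p.2 j)| ^ 2) ∂(π.prod π)

/-- The set of optimal multi-marginal plans with respect to the weights `ρ`. -/
def optimalMultiPlans {N : ℕ} (ρ : Fin N → ℝ) (X : Fin N → GMSpace.{u}) :
    Set (Measure (∀ i, (X i).carrier)) :=
  {π | π ∈ multiPlans X ∧ ∀ σ ∈ multiPlans X, mgwFunctional ρ X π ≤ mgwFunctional ρ X σ}

/-- The barycenter loss `∑ ρ_i GW(X_i, Y)²`. -/
def barycenterLoss {N : ℕ} (ρ : Fin N → ℝ) (X : Fin N → GMSpace.{u}) (Y : GMSpace.{v}) : ℝ≥0∞ :=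
  ∑ i, ENNReal.ofReal (ρ i) * GW (X i) Y ^ 2

/-- `Y` is a (free-support) Gromov–Wasserstein barycenter: it minimizes the loss among all
gm-spaces `Z` (in an arbitrary universe `w`). The loss of a class of homomorphic gm-spaces is, by
definition, the loss of any of its representatives, so minimizing over classes is minimizing over
representatives. -/
def IsGWBarycenter.{w, u', v'} {N : ℕ} (ρ : Fin N → ℝ) (X : Fin N → GMSpace.{u'})
    (Y : GMSpace.{v'}) : Prop :=
  ∀ Z : GMSpace.{w}, barycenterLoss ρ X Y ≤ barycenterLoss ρ X Z

/-- The gm-space `(ℝ^d, ⟨·,·⟩, 𝒩(0, S))`. -/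
abbrev gaussian {d : ℕ} (S : Matrix (Fin d) (Fin d) ℝ) : GMSpace.{0} where
  carrier := EuclideanSpace ℝ (Fin d)
  measure := multivariateGaussian 0 S
  gauge x y := inner ℝ x y
  gauge_symm x y := real_inner_comm y x
  gauge_memLp := by
    have h : Integrable (fun x : EuclideanSpace ℝ (Fin d) => ‖x‖ ^ 2)
        (multivariateGaussian 0 S) :=
      (memLp_two_iff_integrable_sq_norm (by fun_prop)).1 IsGaussian.memLp_two_id
    refine (memLp_two_iff_integrable_sq_norm (by fun_prop)).2
      ((h.mul_prod h).mono (by fun_prop) (.of_forall fun p => ?_))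
    rw [← mul_pow, norm_pow, norm_pow, norm_norm, norm_mul, norm_norm, norm_norm]
    exact pow_le_pow_left₀ (norm_nonneg _) (norm_inner_le_norm p.1 p.2) 2

end GMSpace

/-- The set of diagonal sign matrices `diag(s_1, …, s_d)`, `s_k ∈ {-1, 1}`. -/
def signMatrices (d : ℕ) : Set (Matrix (Fin d) (Fin d) ℝ) :=
  {J | ∃ s : Fin d → ℝ, (∀ k, s k = -1 ∨ s k = 1) ∧ J = Matrix.diagonal s}

/-- `(B | 0)`: the square matrix `B` of size `m` followed by zero columns, with `n` columns in
total (used for `m ≤ n`). -/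
def padCols {m : ℕ} (n : ℕ) (B : Matrix (Fin m) (Fin m) ℝ) : Matrix (Fin m) (Fin n) ℝ :=
  Matrix.of fun k l => if hl : l.val < m then B k ⟨l.val, hl⟩ else 0

/-- The block matrix with upper left block `B` of size `m` and all other blocks zero, of total size
`n` (used for `m ≤ n`). -/
def padSquare {m : ℕ} (n : ℕ) (B : Matrix (Fin m) (Fin m) ℝ) : Matrix (Fin n) (Fin n) ℝ :=
  Matrix.of fun k l =>
    if h : k.val < m ∧ l.val < m then B ⟨k.val, h.1⟩ ⟨l.val, h.2⟩ else 0

/-- The matrix `A = (J D^{1/2} (D₁^{(m)})^{-1/2} | 0) ∈ ℝ^{m × n}`, where `D = diag(lam)`,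
`D₁ = diag(lam₁)` and `D₁^{(m)}` is the upper left `m × m` submatrix of `D₁`. -/
def transportMatrix {m n : ℕ} (h : m ≤ n) (J : Matrix (Fin m) (Fin m) ℝ)
    (lam : Fin m → ℝ) (lam₁ : Fin n → ℝ) : Matrix (Fin m) (Fin n) ℝ :=
  padCols n (J * Matrix.diagonal (fun k => √(lam k)) *
    Matrix.diagonal (fun k => (√(lam₁ (Fin.castLE h k)))⁻¹))

end

/-! Each gauge is a finite-rank kernel `∑ λ_ik u_ik ⊗ u_ik`, where the `u_ik` are the normalized
eigencoordinates, orthonormal in `L²(ξ_i)`, and `λ_i` is the spectrum of the covariance. Both claims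
follow from one sharp constant: the weighted variance of the spectra, extended by zero to the
largest dimension (`spectralVariance`).

Lower bound (`spectralVariance_le`): given plans between the `X_i` and a space `Z` with gauge `h`,
project `u_ik` onto functions of `z`. This gives `m_ik` and `K_i = ∑ λ_ik m_ik ⊗ m_ik`, and the i-th
cost is `‖λ_i‖² - 2⟨K_i, h⟩ + ‖h‖²`. Averaging and completing the square in `h` bounds the loss
below by `∑ ρ_i ‖λ_i‖² - ‖∑ ρ_i K_i‖²`. By Bessel the numbers `⟨m_ik, m_jl⟩²` form a doubly
substochastic matrix, so the rearrangement inequality gives `⟨K_i, K_j⟩ ≤ ∑ λ_ik λ_jk`, and the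
bound becomes the spectral variance. The multi-marginal functional is the weighted cost of
transporting to the plan itself, carrying the mean gauge, so it obeys the same bound.

Attainment (`mgwFunctional_map_eq`, `barycenterLoss_le`): the maps `T_i` pull all gauges back to
kernels that are diagonal in the single orthonormal family belonging to `ξ_1`. Only squares of the
entries of `A_i` enter, so the signs are immaterial. The barycenter is the space whose pulled-back
kernel has the mean spectrum. -/

noncomputable section

/-! ### Orthonormal families and finite-rank kernels in `L²` -/

/-- A family of square-integrable functions which is orthonormal in `L²(μ)`. -/
def IsOrthonormalL2 {Ω ι : Type*} [MeasurableSpace Ω] [DecidableEq ι] (μ : Measure Ω)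
    (u : ι → Ω → ℝ) : Prop :=
  (∀ k, MemLp (u k) 2 μ) ∧ ∀ k l, ∫ ω, u k ω * u l ω ∂μ = if k = l then 1 else 0

lemma integrable_mul_of_memLp_two {Ω : Type*} [MeasurableSpace Ω] {μ : Measure Ω} {f g : Ω → ℝ}
    (hf : MemLp f 2 μ) (hg : MemLp g 2 μ) : Integrable (fun x => f x * g x) μ :=
  hf.integrable_mul hg

lemma memLp_two_tensor {Ω Ω' : Type*} [MeasurableSpace Ω] [MeasurableSpace Ω'] {μ : Measure Ω}
    {μ' : Measure Ω'} [SFinite μ] [SFinite μ'] {f : Ω → ℝ} {g : Ω' → ℝ}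
    (hf : MemLp f 2 μ) (hg : MemLp g 2 μ') :
    MemLp (fun p : Ω × Ω' => f p.1 * g p.2) 2 (μ.prod μ') := by
  refine (memLp_two_iff_integrable_sq (hf.1.comp_fst.mul hg.1.comp_snd)).2 ?_
  simpa only [Pi.mul_apply, mul_pow] using hf.integrable_sq.mul_prod hg.integrable_sq

lemma inner_Lp_eq_integral_mul {Ω : Type*} [MeasurableSpace Ω] {μ : Measure Ω} {a b : Lp ℝ 2 μ}
    {f g : Ω → ℝ} (hf : a =ᵐ[μ] f) (hg : b =ᵐ[μ] g) : inner ℝ a b = ∫ x, f x * g x ∂μ := by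
  rw [L2.inner_def]
  refine integral_congr_ae ?_
  filter_upwards [hf, hg] with x hx hy
  rw [hx, hy, RCLike.inner_apply', conj_trivial]

/-- The square-integrable kernel `∑ c_k m_k ⊗ m_k`. -/
def tensorKernel {Ω ι : Type*} [Fintype ι] (c : ι → ℝ) (m : ι → Ω → ℝ) (p : Ω × Ω) : ℝ :=
  ∑ k, c k * (m k p.1 * m k p.2)

section tensorKernel

variable {Ω ι κ : Type*} [MeasurableSpace Ω] [Fintype ι] [Fintype κ] {μ : Measure Ω}

lemma memLp_tensorKernel [SFinite μ] (c : ι → ℝ) {m : ι → Ω → ℝ} (hm : ∀ k, MemLp (m k) 2 μ) :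
    MemLp (tensorKernel c m) 2 (μ.prod μ) :=
  memLp_finsetSum _ fun k _ => (memLp_two_tensor (hm k) (hm k)).const_mul (c k)

lemma integral_tensorKernel_mul_tensorKernel [SFinite μ] (c : ι → ℝ) (e : κ → ℝ) {m : ι → Ω → ℝ}
    {n : κ → Ω → ℝ} (hm : ∀ k, MemLp (m k) 2 μ) (hn : ∀ k, MemLp (n k) 2 μ) :
    ∫ p, tensorKernel c m p * tensorKernel e n p ∂(μ.prod μ) =
      ∑ k, ∑ l, c k * e l * (∫ x, m k x * n l x ∂μ) ^ 2 := by
  have h (k : ι) (l : κ) := (integrable_mul_of_memLp_two (hm k) (hn l)).mul_prod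
    (integrable_mul_of_memLp_two (hm k) (hn l))
  have e1 : (fun p => tensorKernel c m p * tensorKernel e n p) = fun p : Ω × Ω =>
      ∑ k, ∑ l, c k * e l * (m k p.1 * n l p.1 * (m k p.2 * n l p.2)) := by
    ext p
    rw [tensorKernel, tensorKernel, Finset.sum_mul_sum]
    exact Finset.sum_congr rfl fun k _ => Finset.sum_congr rfl fun l _ => by ring
  rw [e1, integral_finsetSum _ fun k _ => integrable_finsetSum _ fun l _ => (h k l).const_mul _]
  refine Finset.sum_congr rfl fun k _ => ?_
  rw [integral_finsetSum _ fun l _ => (h k l).const_mul _]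
  refine Finset.sum_congr rfl fun l _ => ?_
  rw [integral_const_mul, integral_prod_mul (fun x => m k x * n l x) (fun x => m k x * n l x), sq]

end tensorKernel

namespace IsOrthonormalL2

variable {Ω Z ι : Type*} [MeasurableSpace Ω] [MeasurableSpace Z] [DecidableEq ι]
  {μ : Measure Ω} {ζ : Measure Z} {u : ι → Ω → ℝ}

lemma comp_measurePreserving {Ω' : Type*} [MeasurableSpace Ω'] {ν : Measure Ω'} {f : Ω' → Ω}
    (h : IsOrthonormalL2 μ u) (hf : MeasurePreserving f ν μ) :
    IsOrthonormalL2 ν fun k x => u k (f x) := by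
  refine ⟨fun k => (h.1 k).comp_measurePreserving hf, fun k l => ?_⟩
  rw [← h.2 k l, ← hf.map_eq, integral_map hf.measurable.aemeasurable]
  rw [hf.map_eq]
  exact (h.1 k).1.mul (h.1 l).1

lemma integral_tensorKernel_sq [Fintype ι] [SFinite μ] (h : IsOrthonormalL2 μ u) (c : ι → ℝ) :
    ∫ p, tensorKernel c u p ^ 2 ∂(μ.prod μ) = ∑ k, c k ^ 2 := by
  simp_rw [sq (tensorKernel c u _)]
  rw [integral_tensorKernel_mul_tensorKernel c c h.1 h.1]
  simp [h.2, sq]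

lemma orthonormal_toLp (h : IsOrthonormalL2 μ u) :
    Orthonormal ℝ fun k => (h.1 k).toLp (u k) := by
  rw [orthonormal_iff_ite]
  intro k l
  rw [inner_Lp_eq_integral_mul (h.1 k).coeFn_toLp (h.1 l).coeFn_toLp, h.2 k l]

/-- The conditional expectations `m_k` of an orthonormal family `u_k` given a measure preserving
map `q`, regarded as functions on the target of `q`. -/
lemma exists_projection [Fintype ι] (h : IsOrthonormalL2 μ u) {q : Ω → Z}
    (hq : MeasurePreserving q μ ζ) :
    ∃ m : ι → Z → ℝ, (∀ k, MemLp (m k) 2 ζ) ∧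
      (∀ k f, MemLp f 2 ζ → ∫ ω, u k ω * f (q ω) ∂μ = ∫ z, m k z * f z ∂ζ) ∧
      ∀ f, MemLp f 2 ζ → ∑ k, (∫ z, m k z * f z ∂ζ) ^ 2 ≤ ∫ z, f z ^ 2 ∂ζ := by
  -- Composition with `q` is an isometry of `L²(ζ)` into `L²(μ)`. Its adjoint is the conditional
  -- expectation, and the last claim is Bessel's inequality in `L²(μ)` applied to `f ∘ q`.
  let W : Lp ℝ 2 ζ →ₗᵢ[ℝ] Lp ℝ 2 μ := Lp.compMeasurePreservingₗᵢ ℝ q hq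
  have key (k : ι) (f : Z → ℝ) (hf : MemLp f 2 ζ) :
      inner ℝ ((h.1 k).toLp (u k)) (W (hf.toLp f)) =
        ∫ z, (ContinuousLinearMap.adjoint W.toContinuousLinearMap ((h.1 k).toLp (u k))) z
          * f z ∂ζ := by
    rw [← inner_Lp_eq_integral_mul (Filter.EventuallyEq.refl _ _) hf.coeFn_toLp]
    exact (ContinuousLinearMap.adjoint_inner_left W.toContinuousLinearMap _ _).symm
  have key2 (k : ι) (f : Z → ℝ) (hf : MemLp f 2 ζ) :
      inner ℝ ((h.1 k).toLp (u k)) (W (hf.toLp f)) = ∫ ω, u k ω * f (q ω) ∂μ := by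
    refine inner_Lp_eq_integral_mul (h.1 k).coeFn_toLp ?_
    exact (Lp.coeFn_compMeasurePreserving (hf.toLp f) hq).trans
      (hq.quasiMeasurePreserving.ae hf.coeFn_toLp)
  refine ⟨fun k => ContinuousLinearMap.adjoint W.toContinuousLinearMap ((h.1 k).toLp (u k)),
    fun k => Lp.memLp _, fun k f hf => ?_, fun f hf => ?_⟩
  · rw [← key k f hf, key2]
  · have hb := h.orthonormal_toLp.sum_inner_products_le (W (hf.toLp f)) (s := Finset.univ)
    have hn : ‖W (hf.toLp f)‖ ^ 2 = ∫ z, f z ^ 2 ∂ζ := by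
      rw [W.norm_map, ← real_inner_self_eq_norm_sq,
        inner_Lp_eq_integral_mul hf.coeFn_toLp hf.coeFn_toLp]
      simp_rw [sq]
    rw [← hn]
    refine le_trans (le_of_eq (Finset.sum_congr rfl fun k _ => ?_)) hb
    rw [Real.norm_eq_abs, sq_abs, ← key k f hf]

end IsOrthonormalL2

/-- If `m` is the conditional expectation of `u` given `q`, then `m ⊗ m` is the conditional
expectation of `u ⊗ u` given `q × q`, tested against square-integrable functions. -/
lemma integral_tensor_comp_eq {Ω Z : Type*} [MeasurableSpace Ω] [MeasurableSpace Z]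
    {μ : Measure Ω} {ζ : Measure Z} [IsProbabilityMeasure μ] [IsProbabilityMeasure ζ] {q : Ω → Z}
    (hq : MeasurePreserving q μ ζ) {u : Ω → ℝ} {m : Z → ℝ} (hu : MemLp u 2 μ) (hm : MemLp m 2 ζ)
    (hum : ∀ f, MemLp f 2 ζ → ∫ ω, u ω * f (q ω) ∂μ = ∫ z, m z * f z ∂ζ)
    {h : Z × Z → ℝ} (hh : MemLp h 2 (ζ.prod ζ)) :
    ∫ p, u p.1 * u p.2 * h (q p.1, q p.2) ∂(μ.prod μ) =
      ∫ p, m p.1 * m p.2 * h p ∂(ζ.prod ζ) := by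
  have hqq : MeasurePreserving (fun p : Ω × Ω => (q p.1, q p.2)) (μ.prod μ) (ζ.prod ζ) :=
    hq.prod hq
  have hsec : ∀ᵐ z ∂ζ, MemLp (fun z' => h (z, z')) 2 ζ := by
    filter_upwards [hh.1.prodMk_left, hh.integrable_sq.prod_right_ae] with z h1 h2
    exact (memLp_two_iff_integrable_sq h1).2 h2
  -- The projection property is applied once per variable. After integrating out the second
  -- variable, Cauchy–Schwarz shows that `F` is square-integrable, hence admissible for the second
  -- application.
  let F (z : Z) : ℝ := ∫ z', m z' * h (z, z') ∂ζ
  have hmh : AEStronglyMeasurable (fun p : Z × Z => m p.2 * h p) (ζ.prod ζ) :=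
    hm.1.comp_snd.mul hh.1
  have hF : MemLp F 2 ζ := by
    refine (memLp_two_iff_integrable_sq hmh.integral_prod_right').2 ?_
    have hI := hh.integrable_sq.integral_prod_left.mul_const (∫ z, m z ^ 2 ∂ζ)
    refine hI.mono (hmh.integral_prod_right'.pow 2) ?_
    filter_upwards [hsec] with z hz
    have hcs : (∫ z', m z' * h (z, z') ∂ζ) ^ 2 ≤
        (∫ z', h (z, z') ^ 2 ∂ζ) * ∫ z', m z' ^ 2 ∂ζ := by
      have h1 := inner_Lp_eq_integral_mul hm.coeFn_toLp hz.coeFn_toLp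
      have h2 := inner_Lp_eq_integral_mul hm.coeFn_toLp hm.coeFn_toLp
      have h3 := inner_Lp_eq_integral_mul hz.coeFn_toLp hz.coeFn_toLp
      simp_rw [sq (m _), sq (h _)]
      rw [← h1, ← h2, ← h3, sq, mul_comm (inner ℝ (hz.toLp _) (hz.toLp _))]
      exact real_inner_mul_inner_self_le _ _
    rw [Real.norm_of_nonneg (sq_nonneg _)]
    exact hcs.trans (le_abs_self _)
  have hi1 : Integrable (fun p : Ω × Ω => u p.1 * u p.2 * h (q p.1, q p.2)) (μ.prod μ) :=
    integrable_mul_of_memLp_two (memLp_two_tensor hu hu) (hh.comp_measurePreserving hqq)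
  have hi2 : Integrable (fun p : Z × Z => m p.1 * m p.2 * h p) (ζ.prod ζ) :=
    integrable_mul_of_memLp_two (memLp_two_tensor hm hm) hh
  rw [integral_prod _ hi1, integral_prod _ hi2]
  have e2 (z : Z) : ∫ z', m z * m z' * h (z, z') ∂ζ = m z * F z := by
    rw [← integral_const_mul]
    exact integral_congr_ae (.of_forall fun z' => mul_assoc _ _ _)
  simp_rw [e2]
  rw [← hum F hF]
  refine integral_congr_ae ?_
  filter_upwards [hq.quasiMeasurePreserving.ae hsec] with ω hω
  have e3 : F (q ω) = ∫ ω', u ω' * h (q ω, q ω') ∂μ := (hum _ hω).symm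
  rw [e3, ← integral_const_mul]
  exact integral_congr_ae (.of_forall fun z' => mul_assoc _ _ _)

lemma integral_sub_sq_of_memLp {Ω : Type*} [MeasurableSpace Ω] {μ : Measure Ω} {f g : Ω → ℝ}
    (hf : MemLp f 2 μ) (hg : MemLp g 2 μ) :
    ∫ x, (f x - g x) ^ 2 ∂μ =
      ∫ x, f x ^ 2 ∂μ - 2 * ∫ x, f x * g x ∂μ + ∫ x, g x ^ 2 ∂μ := by
  have hfg := (integrable_mul_of_memLp_two hf hg).const_mul 2
  have h1 : Integrable (fun x => f x ^ 2 - 2 * (f x * g x)) μ := hf.integrable_sq.sub hfg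
  have e (x : Ω) : (f x - g x) ^ 2 = f x ^ 2 - 2 * (f x * g x) + g x ^ 2 := by ring
  simp_rw [e]
  rw [integral_add h1 hg.integrable_sq, integral_sub hf.integrable_sq hfg, integral_const_mul]

/-! ### Rearrangement inequality for zero-extended spectra -/

/-- Extension of a finite sequence by zero. -/
def extendZero {m : ℕ} (a : Fin m → ℝ) (k : ℕ) : ℝ := if h : k < m then a ⟨k, h⟩ else 0

lemma extendZero_val {m : ℕ} (a : Fin m → ℝ) (k : Fin m) : extendZero a k = a k := by
  simp [extendZero]

lemma extendZero_of_le {m k : ℕ} (a : Fin m → ℝ) (h : m ≤ k) : extendZero a k = 0 := by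
  simp [extendZero, h]

lemma extendZero_nonneg {m : ℕ} {a : Fin m → ℝ} (ha : ∀ k, 0 ≤ a k) (k : ℕ) :
    0 ≤ extendZero a k := by
  unfold extendZero
  split_ifs
  exacts [ha _, le_rfl]

lemma antitone_extendZero {m : ℕ} {a : Fin m → ℝ} (ha : Antitone a) (h0 : ∀ k, 0 ≤ a k) :
    Antitone (extendZero a) := by
  intro k l hkl
  by_cases hl : l < m
  · simp only [extendZero, hl, hkl.trans_lt hl, dif_pos]
    exact ha hkl
  · rw [extendZero_of_le a (not_lt.1 hl)]
    exact extendZero_nonneg h0 k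

lemma sum_fin_extendZero {m M : ℕ} (h : m ≤ M) (a : Fin m → ℝ) (f : ℝ → ℕ → ℝ)
    (hf : ∀ k, f 0 k = 0) :
    ∑ k : Fin M, f (extendZero a k) k = ∑ k : Fin m, f (a k) k := by
  rw [Fin.sum_univ_eq_sum_range (fun k => f (extendZero a k) k), ← Finset.sum_subset
    (Finset.range_subset_range.2 h), ← Fin.sum_univ_eq_sum_range]
  · simp_rw [extendZero_val]
  · intro k _ hk
    rw [extendZero_of_le a (by simpa using hk), hf]

/-- Abel summation: the differences telescope from `k` to `M`. For a nonincreasing sequence this is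
a nonnegative combination of indicators of initial segments, which reduces rearrangement to 0-1
sequences. -/
lemma eq_sum_layers {e : ℕ → ℝ} {M k : ℕ} (hM : e M = 0) (hk : k ≤ M) :
    e k = ∑ i ∈ Finset.range M, (e i - e (i + 1)) * if k ≤ i then 1 else 0 := by
  simp_rw [mul_ite, mul_one, mul_zero]
  rw [← Finset.sum_filter]
  have : (Finset.range M).filter (k ≤ ·) = Finset.Ico k M := by ext; simp [and_comm]
  rw [this, Finset.sum_Ico_eq_sum_range]
  have := Finset.sum_range_sub' (fun i => e (k + i)) (M - k)
  simp only [add_zero, Nat.add_sub_cancel' hk, hM, sub_zero] at this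
  exact this.symm

/-- The mass of an upper left corner is at most its number of rows and at most its number of
columns; the shorter side is the one counted on the right. -/
lemma sum_doublySubstochastic_corner_le {m n M : ℕ} (hm : m ≤ M) (hn : n ≤ M)
    {s : Fin m → Fin n → ℝ} (h0 : ∀ k l, 0 ≤ s k l) (hr : ∀ k, ∑ l, s k l ≤ 1)
    (hc : ∀ l, ∑ k, s k l ≤ 1) (i j : ℕ) :
    ∑ k : Fin m, ∑ l : Fin n, (if (k : ℕ) ≤ i then (1 : ℝ) else 0) * (if (l : ℕ) ≤ j then 1 else 0) * s k l ≤
      ∑ k : Fin M, (if (k : ℕ) ≤ i then 1 else 0) * if (k : ℕ) ≤ j then 1 else 0 := by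
  have hpad {m : ℕ} (hm : m ≤ M) (i : ℕ) : ∑ k : Fin m, (if (k : ℕ) ≤ i then (1 : ℝ) else 0) ≤
      ∑ k : Fin M, if (k : ℕ) ≤ i then 1 else 0 := by
    rw [Fin.sum_univ_eq_sum_range (fun k => if k ≤ i then (1 : ℝ) else 0),
      Fin.sum_univ_eq_sum_range (fun k => if k ≤ i then (1 : ℝ) else 0)]
    exact Finset.sum_le_sum_of_subset_of_nonneg (Finset.range_subset_range.2 hm)
      fun k _ _ => by positivity
  rcases le_total i j with hij | hij
  · calc _ ≤ ∑ k : Fin m, (if (k : ℕ) ≤ i then (1 : ℝ) else 0) := by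
          refine Finset.sum_le_sum fun k _ => ?_
          split_ifs
          · refine le_trans (Finset.sum_le_sum fun l _ => ?_) (hr k)
            split_ifs <;> simp [h0]
          · simp
      _ ≤ _ := hpad hm i
      _ ≤ _ := Finset.sum_le_sum fun k _ => by
          by_cases h : (k : ℕ) ≤ i
          · simp [h, h.trans hij]
          · simp [h]
  · rw [Finset.sum_comm]
    calc _ ≤ ∑ l : Fin n, (if (l : ℕ) ≤ j then (1 : ℝ) else 0) := by
          refine Finset.sum_le_sum fun l _ => ?_
          split_ifs
          · refine le_trans (Finset.sum_le_sum fun k _ => ?_) (hc l)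
            split_ifs <;> simp [h0]
          · simp
      _ ≤ _ := hpad hn j
      _ ≤ _ := Finset.sum_le_sum fun k _ => by
          by_cases h : (k : ℕ) ≤ j
          · simp [h, h.trans hij]
          · simp [h]

/-- The rearrangement inequality for doubly substochastic matrices. -/
lemma sum_mul_doublySubstochastic_le {m n M : ℕ} (hm : m ≤ M) (hn : n ≤ M)
    {a : Fin m → ℝ} {b : Fin n → ℝ} (ha : Antitone a) (ha0 : ∀ k, 0 ≤ a k) (hb : Antitone b)
    (hb0 : ∀ k, 0 ≤ b k) {s : Fin m → Fin n → ℝ} (h0 : ∀ k l, 0 ≤ s k l)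
    (hr : ∀ k, ∑ l, s k l ≤ 1) (hc : ∀ l, ∑ k, s k l ≤ 1) :
    ∑ k, ∑ l, a k * b l * s k l ≤ ∑ k : Fin M, extendZero a k * extendZero b k := by
  have hlayer {m : ℕ} (hm : m ≤ M) (a : Fin m → ℝ) {k : ℕ} (hk : k ≤ M) :=
    eq_sum_layers (extendZero_of_le a hm) hk
  have hα {m : ℕ} {a : Fin m → ℝ} (ha : Antitone a) (ha0 : ∀ k, 0 ≤ a k) (i : ℕ) :
      0 ≤ extendZero a i - extendZero a (i + 1) :=
    sub_nonneg.2 (antitone_extendZero ha ha0 i.le_succ)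
  set α := fun i => extendZero a i - extendZero a (i + 1) with hαdef
  set β := fun i => extendZero b i - extendZero b (i + 1) with hβdef
  have expand (k l : ℕ) (hk : k ≤ M) (hl : l ≤ M) : extendZero a k * extendZero b l =
      ∑ i ∈ Finset.range M, ∑ j ∈ Finset.range M, α i * β j *
        ((if k ≤ i then 1 else 0) * if l ≤ j then 1 else 0) := by
    rw [hlayer hm a hk, hlayer hn b hl, Finset.sum_mul_sum]
    exact Finset.sum_congr rfl fun i _ => Finset.sum_congr rfl fun j _ => by simp only [α, β]; ring
  have hL : ∑ k, ∑ l, a k * b l * s k l = ∑ i ∈ Finset.range M, ∑ j ∈ Finset.range M,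
      α i * β j * ∑ k : Fin m, ∑ l : Fin n, (if (k : ℕ) ≤ i then (1 : ℝ) else 0) *
        (if (l : ℕ) ≤ j then 1 else 0) * s k l := by
    have h1 (k : Fin m) (l : Fin n) : a k * b l * s k l =
        ∑ i ∈ Finset.range M, ∑ j ∈ Finset.range M, α i * β j *
          ((if (k : ℕ) ≤ i then 1 else 0) * (if (l : ℕ) ≤ j then 1 else 0) * s k l) := by
      rw [← extendZero_val a k, ← extendZero_val b l,
        expand k l (k.2.le.trans hm) (l.2.le.trans hn), Finset.sum_mul]
      refine Finset.sum_congr rfl fun i _ => ?_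
      rw [Finset.sum_mul]
      exact Finset.sum_congr rfl fun j _ => by ring
    simp_rw [h1, Finset.mul_sum]
    rw [← Finset.sum_product', Finset.sum_comm]
    refine Finset.sum_congr rfl fun i _ => ?_
    rw [Finset.sum_comm]
    refine Finset.sum_congr rfl fun j _ => ?_
    rw [Finset.sum_product]
  have hR : ∑ k : Fin M, extendZero a k * extendZero b k = ∑ i ∈ Finset.range M,
      ∑ j ∈ Finset.range M, α i * β j * ∑ k : Fin M, (if (k : ℕ) ≤ i then (1 : ℝ) else 0) *
        if (k : ℕ) ≤ j then 1 else 0 := by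
    simp_rw [Finset.mul_sum]
    rw [Finset.sum_congr rfl fun (k : Fin M) _ => expand k k k.2.le k.2.le, Finset.sum_comm]
    exact Finset.sum_congr rfl fun i _ => Finset.sum_comm
  rw [hL, hR]
  -- Both sides are now expanded in layers with the same nonnegative coefficients, so the corner
  -- bound applies term by term.
  exact Finset.sum_le_sum fun i _ => Finset.sum_le_sum fun j _ =>
    mul_le_mul_of_nonneg_left (sum_doublySubstochastic_corner_le hm hn h0 hr hc i j)
      (mul_nonneg (hα ha ha0 i) (hα hb hb0 j))

/-! ### The spectral variance as a lower bound -/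

/-- The eigenvalue sequence of the barycenter: the weighted mean of the (zero-extended) spectra. -/
def meanSpectrum {N : ℕ} {d : Fin N → ℕ} (ρ : Fin N → ℝ) (lam : ∀ i, Fin (d i) → ℝ) (k : ℕ) : ℝ :=
  ∑ i, ρ i * extendZero (lam i) k

/-- The weighted variance of the (zero-extended) spectra, which is the optimal barycenter loss. -/
def spectralVariance {N : ℕ} {d : Fin N → ℕ} (M : ℕ) (ρ : Fin N → ℝ)
    (lam : ∀ i, Fin (d i) → ℝ) : ℝ :=
  ∑ i, ρ i * ∑ k : Fin M, (extendZero (lam i) k - meanSpectrum ρ lam k) ^ 2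

/-- Mean of the squares minus square of the mean, for each index `k`; the padding by zeros does not
change the sums of squares. -/
lemma spectralVariance_eq {N : ℕ} {d : Fin N → ℕ} {M : ℕ} (hM : ∀ i, d i ≤ M) {ρ : Fin N → ℝ}
    (hρ : ∑ i, ρ i = 1) (lam : ∀ i, Fin (d i) → ℝ) :
    spectralVariance M ρ lam =
      ∑ i, ρ i * ∑ k, lam i k ^ 2 - ∑ k : Fin M, meanSpectrum ρ lam k ^ 2 := by
  have h1 (i : Fin N) : ∑ k, lam i k ^ 2 = ∑ k : Fin M, extendZero (lam i) k ^ 2 :=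
    (sum_fin_extendZero (hM i) (lam i) (fun x _ => x ^ 2) (by simp)).symm
  simp_rw [spectralVariance, h1, Finset.mul_sum]
  rw [Finset.sum_comm, Finset.sum_comm (t := Finset.univ (α := Fin M)), ← Finset.sum_sub_distrib]
  refine Finset.sum_congr rfl fun k _ => ?_
  have e (i : Fin N) : ρ i * (extendZero (lam i) k - meanSpectrum ρ lam k) ^ 2 =
      ρ i * extendZero (lam i) k ^ 2 - 2 * meanSpectrum ρ lam k * (ρ i * extendZero (lam i) k)
        + ρ i * meanSpectrum ρ lam k ^ 2 := by ring
  simp_rw [e]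
  rw [Finset.sum_add_distrib, Finset.sum_sub_distrib, ← Finset.mul_sum, ← Finset.sum_mul, hρ,
    ← meanSpectrum]
  ring

/-- The weighted mean squared distance of the kernels `∑ λ_{ik} u_{ik} ⊗ u_{ik}` to a common
kernel `h` is at least the variance of their spectra. -/
theorem spectralVariance_le {N : ℕ} {d : Fin N → ℕ} {M : ℕ} (hM : ∀ i, d i ≤ M) {ρ : Fin N → ℝ}
    (hρ : ρ ∈ stdSimplex ℝ (Fin N)) {lam : ∀ i, Fin (d i) → ℝ} (hlam : ∀ i, Antitone (lam i))
    (h0 : ∀ i k, 0 ≤ lam i k) {Ω : Fin N → Type*} {Z : Type*} [∀ i, MeasurableSpace (Ω i)]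
    [MeasurableSpace Z] {μ : ∀ i, Measure (Ω i)} {ζ : Measure Z} [∀ i, IsProbabilityMeasure (μ i)]
    [IsProbabilityMeasure ζ] {u : ∀ i, Fin (d i) → Ω i → ℝ}
    (hu : ∀ i, IsOrthonormalL2 (μ i) (u i)) {q : ∀ i, Ω i → Z}
    (hq : ∀ i, MeasurePreserving (q i) (μ i) ζ) {h : Z × Z → ℝ} (hh : MemLp h 2 (ζ.prod ζ)) :
    spectralVariance M ρ lam ≤ ∑ i, ρ i * ∫ p, (tensorKernel (lam i) (u i) p -
      h (q i p.1, q i p.2)) ^ 2 ∂((μ i).prod (μ i)) := by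
  choose m hm hproj hbessel using fun i => (hu i).exists_projection (hq i)
  have hqq (i) : MeasurePreserving (fun p : Ω i × Ω i => (q i p.1, q i p.2))
    ((μ i).prod (μ i)) (ζ.prod ζ) := (hq i).prod (hq i)
  let K (i : Fin N) : Z × Z → ℝ := tensorKernel (lam i) (m i)
  have hK (i) : MemLp (K i) 2 (ζ.prod ζ) := memLp_tensorKernel _ (hm i)
  have hcost (i) : ∫ p, (tensorKernel (lam i) (u i) p - h (q i p.1, q i p.2)) ^ 2
      ∂((μ i).prod (μ i)) = ∑ k, lam i k ^ 2 - 2 * ∫ p, K i p * h p ∂(ζ.prod ζ) +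
        ∫ p, h p ^ 2 ∂(ζ.prod ζ) := by
    have hT := memLp_tensorKernel (lam i) (hu i).1
    have hH : MemLp (fun p : Ω i × Ω i => h (q i p.1, q i p.2)) 2 ((μ i).prod (μ i)) :=
      hh.comp_measurePreserving (hqq i)
    have e2 : ∫ p, h (q i p.1, q i p.2) ^ 2 ∂((μ i).prod (μ i)) =
        ∫ p, h p ^ 2 ∂(ζ.prod ζ) := by
      rw [← (hqq i).map_eq, integral_map (hqq i).measurable.aemeasurable]
      rw [(hqq i).map_eq]
      exact hh.1.pow 2
    have e3 : ∫ p, tensorKernel (lam i) (u i) p * h (q i p.1, q i p.2) ∂((μ i).prod (μ i)) =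
        ∫ p, K i p * h p ∂(ζ.prod ζ) := by
      simp_rw [K, tensorKernel, Finset.sum_mul, mul_assoc (lam i _)]
      rw [integral_finsetSum _ fun k _ => (integrable_mul_of_memLp_two
          (memLp_two_tensor ((hu i).1 k) ((hu i).1 k)) hH).const_mul _,
        integral_finsetSum _ fun k _ => (integrable_mul_of_memLp_two
          (memLp_two_tensor (hm i k) (hm i k)) hh).const_mul _]
      refine Finset.sum_congr rfl fun k _ => ?_
      rw [integral_const_mul, integral_const_mul,
        integral_tensor_comp_eq (hq i) ((hu i).1 k) (hm i k) (hproj i k) hh]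
    rw [integral_sub_sq_of_memLp hT hH, e2, e3, (hu i).integral_tensorKernel_sq]
  -- Testing Bessel against `m_ik` itself gives `t² ≤ t` for `t = ‖m_ik‖²`, hence `t ≤ 1`.
  have hself (i) (k) : ∫ z, m i k z ^ 2 ∂ζ ≤ 1 := by
    have h1 := (Finset.single_le_sum (f := fun l => (∫ z, m i l z * m i k z ∂ζ) ^ 2)
      (fun l _ => sq_nonneg _) (Finset.mem_univ k)).trans (hbessel i _ (hm i k))
    simp_rw [← sq] at h1
    have h2 : 0 ≤ ∫ z, m i k z ^ 2 ∂ζ := integral_nonneg fun z => sq_nonneg _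
    nlinarith
  -- Row and column sums are at most 1: Bessel for one family is tested against a member of the
  -- other, whose norm is at most 1.
  have hcross (i j) : ∑ k, ∑ l, lam i k * lam j l * (∫ z, m i k z * m j l z ∂ζ) ^ 2 ≤
      ∑ k : Fin M, extendZero (lam i) k * extendZero (lam j) k := by
    refine sum_mul_doublySubstochastic_le (hM i) (hM j) (hlam i) (h0 i) (hlam j) (h0 j)
      (fun _ _ => sq_nonneg _) (fun k => ?_) fun l => (hbessel i _ (hm j l)).trans (hself j l)
    simp_rw [mul_comm (m i k _)]
    exact (hbessel j _ (hm i k)).trans (hself i k)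
  let G (p : Z × Z) : ℝ := ∑ i, ρ i * K i p
  have hG : MemLp G 2 (ζ.prod ζ) := memLp_finsetSum _ fun i _ => (hK i).const_mul _
  have hGh : ∫ p, G p * h p ∂(ζ.prod ζ) = ∑ i, ρ i * ∫ p, K i p * h p ∂(ζ.prod ζ) := by
    simp_rw [G, Finset.sum_mul, mul_assoc]
    rw [integral_finsetSum _ fun i _ => (integrable_mul_of_memLp_two (hK i) hh).const_mul _]
    simp_rw [integral_const_mul]
  have hGG : ∫ p, G p ^ 2 ∂(ζ.prod ζ) ≤ ∑ k : Fin M, meanSpectrum ρ lam k ^ 2 := by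
    have e (p : Z × Z) : G p ^ 2 = ∑ i, ∑ j, ρ i * ρ j * (K i p * K j p) := by
      simp_rw [sq, G]
      rw [Finset.sum_mul_sum]
      exact Finset.sum_congr rfl fun i _ => Finset.sum_congr rfl fun j _ => by ring
    have hI (i j) := (integrable_mul_of_memLp_two (hK i) (hK j)).const_mul (ρ i * ρ j)
    have e' : ∑ k : Fin M, meanSpectrum ρ lam k ^ 2 = ∑ i, ∑ j, ρ i * ρ j *
        ∑ k : Fin M, extendZero (lam i) k * extendZero (lam j) k := by
      simp_rw [sq, meanSpectrum, Finset.sum_mul_sum, Finset.mul_sum]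
      rw [Finset.sum_comm]
      refine Finset.sum_congr rfl fun i _ => ?_
      rw [Finset.sum_comm]
      exact Finset.sum_congr rfl fun j _ => Finset.sum_congr rfl fun k _ => by ring
    simp_rw [e]
    rw [integral_finsetSum _ fun i _ => integrable_finsetSum _ fun j _ => hI i j, e']
    refine Finset.sum_le_sum fun i _ => ?_
    rw [integral_finsetSum _ fun j _ => hI i j]
    refine Finset.sum_le_sum fun j _ => ?_
    rw [integral_const_mul, integral_tensorKernel_mul_tensorKernel _ _ (hm i) (hm j)]
    exact mul_le_mul_of_nonneg_left (hcross i j) (mul_nonneg (hρ.1 i) (hρ.1 j))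
  -- Completing the square: `‖h‖² - 2⟨G, h⟩ ≥ -‖G‖²`, which removes the dependence on `h`.
  have hsq : 0 ≤ ∫ p, (G p - h p) ^ 2 ∂(ζ.prod ζ) := integral_nonneg fun p => sq_nonneg _
  rw [integral_sub_sq_of_memLp hG hh, hGh] at hsq
  simp_rw [hcost, mul_add, mul_sub]
  rw [Finset.sum_add_distrib, Finset.sum_sub_distrib, ← Finset.sum_mul, hρ.2,
    spectralVariance_eq hM hρ.2]
  simp_rw [mul_left_comm (ρ _) 2, ← Finset.mul_sum]
  linarith

/-! ### Squared norms and weighted variances -/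

lemma eLpNorm_two_sq {Ω : Type*} [MeasurableSpace Ω] {μ : Measure Ω} (f : Ω → ℝ) :
    eLpNorm f 2 μ ^ 2 = ∫⁻ x, ENNReal.ofReal (f x ^ 2) ∂μ := by
  have h := eLpNorm_nnreal_pow_eq_lintegral (f := f) (μ := μ) (p := 2) two_ne_zero
  simp only [NNReal.coe_ofNat, ENNReal.rpow_ofNat, ENNReal.coe_ofNat] at h
  rw [h]
  refine lintegral_congr fun x => ?_
  rw [Real.enorm_eq_ofReal_abs, ← ENNReal.ofReal_pow (abs_nonneg _), sq_abs]

lemma IsOrthonormalL2.lintegral_tensorKernel_sq {Ω ι : Type*} [MeasurableSpace Ω] [Fintype ι]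
    [DecidableEq ι] {μ : Measure Ω} [SFinite μ] {u : ι → Ω → ℝ} (h : IsOrthonormalL2 μ u)
    (c : ι → ℝ) :
    ∫⁻ p, ENNReal.ofReal (tensorKernel c u p ^ 2) ∂(μ.prod μ) = ENNReal.ofReal (∑ k, c k ^ 2) := by
  rw [← h.integral_tensorKernel_sq c, ofReal_integral_eq_lintegral_ofReal
    (memLp_tensorKernel c h.1).integrable_sq (.of_forall fun _ => sq_nonneg _)]

/-- The two forms of a weighted variance, by pairwise differences and by deviation from the mean.
This links the multi-marginal functional to the barycenter loss. -/
lemma half_sum_sum_sq_sub_eq {N : ℕ} {ρ : Fin N → ℝ} (hρ : ∑ i, ρ i = 1) (a : Fin N → ℝ) :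
    (1 / 2) * ∑ i, ∑ j, ρ i * ρ j * |a i - a j| ^ 2 =
      ∑ i, ρ i * (a i - ∑ j, ρ j * a j) ^ 2 := by
  set b := ∑ j, ρ j * a j with hb
  have h1 (i : Fin N) : ∑ j, ρ i * ρ j * |a i - a j| ^ 2 =
      ρ i * (a i ^ 2 - 2 * a i * b + ∑ j, ρ j * a j ^ 2) := by
    have e (j : Fin N) : ρ i * ρ j * |a i - a j| ^ 2 =
        ρ i * a i ^ 2 * ρ j - ρ i * (2 * a i) * (ρ j * a j) + ρ i * (ρ j * a j ^ 2) := by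
      rw [sq_abs]; ring
    simp_rw [e]
    rw [Finset.sum_add_distrib, Finset.sum_sub_distrib, ← Finset.mul_sum, ← Finset.mul_sum,
      ← Finset.mul_sum, hρ, ← hb]
    ring
  have e2 (i : Fin N) : ρ i * (a i ^ 2 - 2 * a i * b + ∑ j, ρ j * a j ^ 2) =
      ρ i * a i ^ 2 - 2 * b * (ρ i * a i) + ρ i * ∑ j, ρ j * a j ^ 2 := by ring
  have e3 (i : Fin N) : ρ i * (a i - b) ^ 2 =
      ρ i * a i ^ 2 - 2 * b * (ρ i * a i) + ρ i * b ^ 2 := by ring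
  simp_rw [h1, e2, e3, Finset.sum_add_distrib, Finset.sum_sub_distrib, ← Finset.mul_sum,
    ← Finset.sum_mul, hρ, ← hb]
  ring

lemma tensorKernel_sub {Ω ι : Type*} [Fintype ι] (a b : ι → ℝ) (v : ι → Ω → ℝ) (p : Ω × Ω) :
    tensorKernel a v p - tensorKernel b v p = tensorKernel (fun k => a k - b k) v p := by
  simp only [tensorKernel, sub_mul, Finset.sum_sub_distrib]

lemma tensorKernel_meanSpectrum {N M : ℕ} {d : Fin N → ℕ} (ρ : Fin N → ℝ)
    (lam : ∀ i, Fin (d i) → ℝ) {Ω : Type*} (v : Fin M → Ω → ℝ) (p : Ω × Ω) :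
    tensorKernel (fun k : Fin M => meanSpectrum ρ lam k) v p =
      ∑ i, ρ i * tensorKernel (fun k : Fin M => extendZero (lam i) k) v p := by
  simp only [tensorKernel, meanSpectrum, Finset.mul_sum, Finset.sum_mul]
  rw [Finset.sum_comm]
  exact Finset.sum_congr rfl fun i _ => Finset.sum_congr rfl fun k _ => by ring

/-! ### Transport plans and the Gromov–Wasserstein functional -/

namespace GMSpace

lemma measurePreserving_fst_of_mem_plans {X : GMSpace.{u}} {Y : GMSpace.{v}}
    {π : Measure (X.carrier × Y.carrier)} (h : π ∈ plans X Y) :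
    MeasurePreserving Prod.fst π X.measure := ⟨measurable_fst, h.2.1⟩

lemma measurePreserving_snd_of_mem_plans {X : GMSpace.{u}} {Y : GMSpace.{v}}
    {π : Measure (X.carrier × Y.carrier)} (h : π ∈ plans X Y) :
    MeasurePreserving Prod.snd π Y.measure := ⟨measurable_snd, h.2.2⟩

lemma memLp_gauge_comp {Ω : Type*} [MeasurableSpace Ω] {μ : Measure Ω} [SFinite μ]
    {X : GMSpace.{u}} {f : Ω → X.carrier} (hf : MeasurePreserving f μ X.measure) :
    MemLp (fun p : Ω × Ω => X.gauge (f p.1) (f p.2)) 2 (μ.prod μ) :=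
  X.gauge_memLp.comp_measurePreserving (hf.prod hf)

lemma gwFunctional_sq_eq_ofReal {X : GMSpace.{u}} {Y : GMSpace.{v}}
    {π : Measure (X.carrier × Y.carrier)} (h : π ∈ plans X Y) :
    gwFunctional X Y π ^ 2 = ENNReal.ofReal (∫ p, (X.gauge p.1.1 p.2.1 - Y.gauge p.1.2 p.2.2) ^ 2
      ∂(π.prod π)) := by
  have := h.1
  rw [gwFunctional, eLpNorm_two_sq, ofReal_integral_eq_lintegral_ofReal _
    (.of_forall fun _ => sq_nonneg _)]
  exact ((memLp_gauge_comp (measurePreserving_fst_of_mem_plans h)).sub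
    (memLp_gauge_comp (measurePreserving_snd_of_mem_plans h))).integrable_sq

section map

variable {Ω : Type*} [MeasurableSpace Ω] {μ : Measure Ω} [IsProbabilityMeasure μ] {X : GMSpace.{u}}
  {Y : GMSpace.{v}} {f : Ω → X.carrier} {g : Ω → Y.carrier}

lemma map_mem_plans (hf : MeasurePreserving f μ X.measure) (hg : MeasurePreserving g μ Y.measure) :
    μ.map (fun ω => (f ω, g ω)) ∈ plans X Y := by
  have hm := hf.measurable.prodMk hg.measurable
  refine ⟨Measure.isProbabilityMeasure_map hm.aemeasurable, ?_, ?_⟩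
  · rw [Measure.map_map measurable_fst hm]
    exact hf.map_eq
  · rw [Measure.map_map measurable_snd hm]
    exact hg.map_eq

lemma gwFunctional_map_sq (hf : MeasurePreserving f μ X.measure)
    (hg : MeasurePreserving g μ Y.measure) :
    gwFunctional X Y (μ.map fun ω => (f ω, g ω)) ^ 2 =
      ∫⁻ p, ENNReal.ofReal ((X.gauge (f p.1) (f p.2) - Y.gauge (g p.1) (g p.2)) ^ 2)
        ∂(μ.prod μ) := by
  have hπ := map_mem_plans hf hg
  have := hπ.1
  have hm : MeasurePreserving (fun ω => (f ω, g ω)) μ (μ.map fun ω => (f ω, g ω)) :=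
    ⟨hf.measurable.prodMk hg.measurable, rfl⟩
  have hF : AEStronglyMeasurable (fun p : (X.carrier × Y.carrier) × (X.carrier × Y.carrier) =>
      X.gauge p.1.1 p.2.1 - Y.gauge p.1.2 p.2.2)
      ((μ.map fun ω => (f ω, g ω)).prod (μ.map fun ω => (f ω, g ω))) :=
    ((memLp_gauge_comp (measurePreserving_fst_of_mem_plans hπ)).sub
      (memLp_gauge_comp (measurePreserving_snd_of_mem_plans hπ))).1
  rw [gwFunctional, ← eLpNorm_comp_measurePreserving hF (hm.prod hm), eLpNorm_two_sq]
  rfl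

/-- Any two measure preserving maps from a common probability space induce a plan, whose cost can be
computed upstairs. -/
lemma GW_sq_le (hf : MeasurePreserving f μ X.measure) (hg : MeasurePreserving g μ Y.measure) :
    GW X Y ^ 2 ≤ ∫⁻ p, ENNReal.ofReal ((X.gauge (f p.1) (f p.2) - Y.gauge (g p.1) (g p.2)) ^ 2)
      ∂(μ.prod μ) := by
  rw [← gwFunctional_map_sq hf hg]
  exact pow_le_pow_left₀ zero_le (iInf₂_le _ (map_mem_plans hf hg)) 2

end map

/-- Near-optimal plans suffice for the lower bound, so existence of optimal plans is never needed.
-/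
lemma exists_plan_sq_le (X : GMSpace.{u}) (Y : GMSpace.{v}) {ε : ℝ≥0∞} (hε : ε ≠ 0) :
    ∃ π ∈ plans X Y, gwFunctional X Y π ^ 2 ≤ GW X Y ^ 2 + ε := by
  have hprod : X.measure.prod Y.measure ∈ plans X Y :=
    ⟨inferInstance, Measure.fst_prod, Measure.snd_prod⟩
  by_cases htop : GW X Y = ⊤
  · exact ⟨_, hprod, by simp [htop]⟩
  have hlt : GW X Y ^ 2 < GW X Y ^ 2 + ε :=
    ENNReal.lt_add_right (ENNReal.pow_ne_top htop) hε
  have hlt' : GW X Y < (GW X Y ^ 2 + ε) ^ ((2 : ℝ)⁻¹) := by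
    rw [ENNReal.lt_rpow_inv_iff two_pos, ENNReal.rpow_two]
    exact hlt
  obtain ⟨π, hπ, h⟩ := by simpa only [GW, iInf_lt_iff, exists_prop] using hlt'
  refine ⟨π, hπ, ?_⟩
  have h2 := (ENNReal.lt_rpow_inv_iff two_pos).1 h
  rw [ENNReal.rpow_two] at h2
  exact h2.le

/-- The gauge of `X` has the spectral decomposition `∑ λ_k u_k ⊗ u_k` with `u` orthonormal and
`λ` nonincreasing and nonnegative. -/
structure IsSpectral (X : GMSpace.{u}) {n : ℕ} (lam : Fin n → ℝ) (w : Fin n → X.carrier → ℝ) :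
    Prop where
  antitone : Antitone lam
  nonneg : ∀ k, 0 ≤ lam k
  orthonormal : IsOrthonormalL2 X.measure w
  gauge_eq : ∀ x x', X.gauge x x' = tensorKernel lam w (x, x')

/-! ### Lower bounds for the loss and for the multi-marginal functional -/

section lowerBound

variable {N : ℕ} {d : Fin N → ℕ} {M : ℕ} {ρ : Fin N → ℝ} {X : Fin N → GMSpace.{u}}
  {lam : ∀ i, Fin (d i) → ℝ} {w : ∀ i, Fin (d i) → (X i).carrier → ℝ}

/-- Each plan stays on its own space `X_i × Z`, with the second projection as `q i`. Only the
projections to `Z` are compared, so the plans need not be glued. -/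
lemma spectralVariance_le_sum_gwFunctional_sq (hM : ∀ i, d i ≤ M) (hρ : ρ ∈ stdSimplex ℝ (Fin N))
    (hX : ∀ i, (X i).IsSpectral (lam i) (w i)) {Z : GMSpace.{v}}
    {π : ∀ i, Measure ((X i).carrier × Z.carrier)} (hπ : ∀ i, π i ∈ plans (X i) Z) :
    ENNReal.ofReal (spectralVariance M ρ lam) ≤
      ∑ i, ENNReal.ofReal (ρ i) * gwFunctional (X i) Z (π i) ^ 2 := by
  have := fun i => (hπ i).1
  have h := spectralVariance_le hM hρ (fun i => (hX i).antitone) (fun i => (hX i).nonneg)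
    (fun i => (hX i).orthonormal.comp_measurePreserving
      (measurePreserving_fst_of_mem_plans (hπ i)))
    (fun i => measurePreserving_snd_of_mem_plans (hπ i)) Z.gauge_memLp
  refine (ENNReal.ofReal_le_ofReal h).trans (le_of_eq ?_)
  rw [ENNReal.ofReal_sum_of_nonneg fun i _ =>
    mul_nonneg (hρ.1 i) (integral_nonneg fun _ => sq_nonneg _)]
  refine Finset.sum_congr rfl fun i _ => ?_
  rw [ENNReal.ofReal_mul (hρ.1 i), gwFunctional_sq_eq_ofReal (hπ i)]
  simp_rw [(hX i).gauge_eq]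
  rfl

theorem spectralVariance_le_barycenterLoss (hM : ∀ i, d i ≤ M) (hρ : ρ ∈ stdSimplex ℝ (Fin N))
    (hX : ∀ i, (X i).IsSpectral (lam i) (w i)) (Z : GMSpace.{v}) :
    ENNReal.ofReal (spectralVariance M ρ lam) ≤ barycenterLoss ρ X Z := by
  refine ENNReal.le_of_forall_pos_le_add fun ε hε _ => ?_
  choose π hπ hle using fun i => exists_plan_sq_le (X i) Z (ε := ε) (by exact_mod_cast hε.ne')
  refine (spectralVariance_le_sum_gwFunctional_sq hM hρ hX hπ).trans ?_
  refine (Finset.sum_le_sum fun i _ => mul_le_mul_right (hle i) _).trans (le_of_eq ?_)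
  simp_rw [mul_add]
  -- Since the weights sum to 1, the individual errors `ε` average to `ε`.
  rw [Finset.sum_add_distrib, ← Finset.sum_mul,
    ← ENNReal.ofReal_sum_of_nonneg fun i _ => hρ.1 i, hρ.2, ENNReal.ofReal_one, one_mul]
  rfl

lemma mgwFunctional_eq_sum (hρ : ρ ∈ stdSimplex ℝ (Fin N)) {σ : Measure (∀ i, (X i).carrier)}
    (hσ : σ ∈ multiPlans X) :
    mgwFunctional ρ X σ = ∑ i, ENNReal.ofReal (ρ i) *
      ∫⁻ p, ENNReal.ofReal (((X i).gauge (p.1 i) (p.2 i) -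
        ∑ j, ρ j * (X j).gauge (p.1 j) (p.2 j)) ^ 2) ∂(σ.prod σ) := by
  have := hσ.1
  have hev (i) : MeasurePreserving (fun x : ∀ i, (X i).carrier => x i) σ (X i).measure :=
    ⟨measurable_pi_apply i, hσ.2 i⟩
  have hL (i) := memLp_gauge_comp (hev i)
  have hsub (i) := (hL i).sub (memLp_finsetSum Finset.univ fun j _ => (hL j).const_mul (ρ j))
  have hmeas (i) : AEMeasurable (fun p : (∀ i, (X i).carrier) × (∀ i, (X i).carrier) =>
      ENNReal.ofReal (((X i).gauge (p.1 i) (p.2 i) -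
        ∑ j, ρ j * (X j).gauge (p.1 j) (p.2 j)) ^ 2)) (σ.prod σ) :=
    (hsub i).integrable_sq.1.aemeasurable.ennreal_ofReal
  simp_rw [mgwFunctional]
  rw [← Finset.sum_congr rfl fun i _ => lintegral_const_mul'' (ENNReal.ofReal (ρ i)) (hmeas i),
    ← lintegral_finsetSum' _ fun i _ => (hmeas i).const_mul _]
  refine lintegral_congr fun p => ?_
  rw [half_sum_sum_sq_sub_eq hρ.2, ENNReal.ofReal_sum_of_nonneg fun i _ =>
    mul_nonneg (hρ.1 i) (sq_nonneg _)]
  exact Finset.sum_congr rfl fun i _ => ENNReal.ofReal_mul (hρ.1 i)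

/-- The product space with the weighted mean of the gauges, equipped with a multi-marginal plan. -/
def meanSpace (ρ : Fin N → ℝ) {σ : Measure (∀ i, (X i).carrier)} (hσ : σ ∈ multiPlans X) :
    GMSpace.{u} :=
  have := hσ.1
  { carrier := ∀ i, (X i).carrier
    measure := σ
    gauge := fun x x' => ∑ j, ρ j * (X j).gauge (x j) (x' j)
    gauge_symm := fun x x' => Finset.sum_congr rfl fun j _ => by rw [(X j).gauge_symm]
    gauge_memLp := memLp_finsetSum Finset.univ fun j _ =>
      (memLp_gauge_comp (X := X j) (f := fun x : ∀ i, (X i).carrier => x j)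
        ⟨measurable_pi_apply j, hσ.2 j⟩).const_mul (ρ j) }

/-- The functional at `σ` is the weighted cost of coupling each `X i` with `meanSpace` through the
coordinate maps, hence at least the barycenter loss of that space. -/
theorem spectralVariance_le_mgwFunctional (hM : ∀ i, d i ≤ M) (hρ : ρ ∈ stdSimplex ℝ (Fin N))
    (hX : ∀ i, (X i).IsSpectral (lam i) (w i)) {σ : Measure (∀ i, (X i).carrier)}
    (hσ : σ ∈ multiPlans X) :
    ENNReal.ofReal (spectralVariance M ρ lam) ≤ mgwFunctional ρ X σ := by
  have := hσ.1
  rw [mgwFunctional_eq_sum hρ hσ]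
  refine (spectralVariance_le_barycenterLoss hM hρ hX (meanSpace ρ hσ)).trans ?_
  refine Finset.sum_le_sum fun i _ => mul_le_mul_right ?_ _
  exact GW_sq_le (X := X i) (Y := meanSpace ρ hσ) (f := fun x : ∀ i, (X i).carrier => x i)
    (g := fun x : ∀ i, (X i).carrier => x) ⟨measurable_pi_apply i, hσ.2 i⟩ (.id σ)

end lowerBound

/-! ### Attainment by simultaneous diagonalization -/

section upperBound

variable {N : ℕ} {d : Fin N → ℕ} {M : ℕ} {ρ : Fin N → ℝ} {X : Fin N → GMSpace.{u}}
  {lam : ∀ i, Fin (d i) → ℝ} {Ω : Type*} [MeasurableSpace Ω] {μ : Measure Ω}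
  [IsProbabilityMeasure μ] {v : Fin M → Ω → ℝ} {f : ∀ i, Ω → (X i).carrier}

lemma ofReal_spectralVariance (hρ : ρ ∈ stdSimplex ℝ (Fin N)) :
    ENNReal.ofReal (spectralVariance M ρ lam) = ∑ i, ENNReal.ofReal (ρ i) *
      ENNReal.ofReal (∑ k : Fin M, (extendZero (lam i) k - meanSpectrum ρ lam k) ^ 2) := by
  rw [spectralVariance, ENNReal.ofReal_sum_of_nonneg fun i _ =>
    mul_nonneg (hρ.1 i) (Finset.sum_nonneg fun _ _ => sq_nonneg _)]
  exact Finset.sum_congr rfl fun i _ => ENNReal.ofReal_mul (hρ.1 i)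

/-- A coupling that diagonalizes all gauges simultaneously attains the spectral variance. -/
lemma mgwFunctional_map_eq (hρ : ρ ∈ stdSimplex ℝ (Fin N)) (hv : IsOrthonormalL2 μ v)
    (hf : ∀ i, MeasurePreserving (f i) μ (X i).measure)
    (hgauge : ∀ i ω ω', (X i).gauge (f i ω) (f i ω') =
      tensorKernel (fun k : Fin M => extendZero (lam i) k) v (ω, ω')) :
    μ.map (fun ω i => f i ω) ∈ multiPlans X ∧
      mgwFunctional ρ X (μ.map fun ω i => f i ω) = ENNReal.ofReal (spectralVariance M ρ lam) := by
  have hm : Measurable fun ω i => f i ω := measurable_pi_lambda _ fun i => (hf i).measurable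
  have hmem : μ.map (fun ω i => f i ω) ∈ multiPlans X := by
    refine ⟨Measure.isProbabilityMeasure_map hm.aemeasurable, fun i => ?_⟩
    rw [Measure.map_map (measurable_pi_apply i) hm]
    exact (hf i).map_eq
  refine ⟨hmem, ?_⟩
  have := hmem.1
  have hmp : MeasurePreserving (fun ω i => f i ω) μ (μ.map fun ω i => f i ω) := ⟨hm, rfl⟩
  rw [mgwFunctional_eq_sum hρ hmem, ofReal_spectralVariance hρ]
  refine Finset.sum_congr rfl fun i _ => ?_
  rw [← hv.lintegral_tensorKernel_sq]
  have hsub := (memLp_gauge_comp (X := X i) (f := fun x : ∀ i, (X i).carrier => x i)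
      ⟨measurable_pi_apply i, hmem.2 i⟩).sub (meanSpace ρ hmem).gauge_memLp
  congr 1
  rw [← (hmp.prod hmp).map_eq, lintegral_map']
  · refine lintegral_congr fun p => ?_
    simp only [Prod.map]
    simp_rw [hgauge]
    rw [← tensorKernel_meanSpectrum, tensorKernel_sub]
  · rw [(hmp.prod hmp).map_eq]
    exact hsub.integrable_sq.1.aemeasurable.ennreal_ofReal
  · exact (hmp.prod hmp).measurable.aemeasurable

/-- Pulled back to `Ω`, the gauges of `X i` and `Y` are diagonal in the same orthonormal family, so
the squared `L²` distance is that of the coefficient sequences. -/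
lemma barycenterLoss_le (hρ : ρ ∈ stdSimplex ℝ (Fin N)) (hv : IsOrthonormalL2 μ v)
    (hf : ∀ i, MeasurePreserving (f i) μ (X i).measure)
    (hgauge : ∀ i ω ω', (X i).gauge (f i ω) (f i ω') =
      tensorKernel (fun k : Fin M => extendZero (lam i) k) v (ω, ω'))
    {Y : GMSpace.{v}} {g : Ω → Y.carrier} (hg : MeasurePreserving g μ Y.measure)
    (hgY : ∀ ω ω', Y.gauge (g ω) (g ω') =
      tensorKernel (fun k : Fin M => meanSpectrum ρ lam k) v (ω, ω')) :
    barycenterLoss ρ X Y ≤ ENNReal.ofReal (spectralVariance M ρ lam) := by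
  rw [ofReal_spectralVariance hρ]
  refine Finset.sum_le_sum fun i _ => mul_le_mul_right ((GW_sq_le (hf i) hg).trans ?_) _
  rw [← hv.lintegral_tensorKernel_sq]
  refine le_of_eq (lintegral_congr fun p => ?_)
  rw [hgauge, hgY, tensorKernel_sub]

end upperBound

end GMSpace

/-! ### Gaussian measures and their eigencoordinates -/

lemma euclidean_inner_eq_dotProduct {n : ℕ} (x y : EuclideanSpace ℝ (Fin n)) :
    inner ℝ x y = x.ofLp ⬝ᵥ y.ofLp := by
  rw [EuclideanSpace.inner_eq_star_dotProduct, star_trivial, dotProduct_comm]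

lemma ofLp_toEuclideanLin {m n : ℕ} (A : Matrix (Fin m) (Fin n) ℝ) (x : EuclideanSpace ℝ (Fin n)) :
    (Matrix.toEuclideanLin A x).ofLp = A *ᵥ x.ofLp := rfl

/-- By characteristic functions: the linear map moves to the frequency variable as its transpose.
The covariance may be singular. -/
lemma measurePreserving_toEuclideanLin_multivariateGaussian {m n : ℕ}
    {S : Matrix (Fin n) (Fin n) ℝ} (hS : S.PosSemidef) (A : Matrix (Fin m) (Fin n) ℝ) :
    MeasurePreserving (Matrix.toEuclideanLin A) (multivariateGaussian 0 S)
      (multivariateGaussian 0 (A * S * Aᵀ)) := by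
  have hm : Measurable (Matrix.toEuclideanLin A) :=
    (LinearMap.continuous_of_finiteDimensional _).measurable
  have hS' : (A * S * Aᵀ).PosSemidef := by
    simpa [Matrix.conjTranspose_eq_transpose_of_trivial] using hS.mul_mul_conjTranspose_same A
  have : IsProbabilityMeasure ((multivariateGaussian 0 S).map (Matrix.toEuclideanLin A)) :=
    Measure.isProbabilityMeasure_map hm.aemeasurable
  refine ⟨hm, Measure.ext_of_charFun (funext fun t => ?_)⟩
  have h1 : charFun ((multivariateGaussian 0 S).map (Matrix.toEuclideanLin A)) t =
      charFun (multivariateGaussian 0 S) (Matrix.toEuclideanLin Aᵀ t) := by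
    rw [charFun_apply, charFun_apply, integral_map hm.aemeasurable (by fun_prop)]
    refine integral_congr_ae (.of_forall fun x => ?_)
    simp only [euclidean_inner_eq_dotProduct, ofLp_toEuclideanLin]
    rw [Matrix.mulVec_transpose, dotProduct_comm (A *ᵥ x.ofLp), Matrix.dotProduct_mulVec,
      dotProduct_comm x.ofLp]
  rw [h1, charFun_multivariateGaussian hS, charFun_multivariateGaussian hS', inner_zero_right,
    inner_zero_right, ofLp_toEuclideanLin, ← Matrix.mulVec_mulVec, ← Matrix.mulVec_mulVec]
  congr 4
  rw [Matrix.dotProduct_mulVec t.ofLp A, Matrix.mulVec_transpose]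

lemma integral_inner_mul_inner_multivariateGaussian {n : ℕ} {S : Matrix (Fin n) (Fin n) ℝ}
    (hS : S.PosSemidef) (a b : EuclideanSpace ℝ (Fin n)) :
    ∫ x, inner ℝ a x * inner ℝ b x ∂(multivariateGaussian 0 S) = a.ofLp ⬝ᵥ S *ᵥ b.ofLp := by
  rw [← covarianceBilin_multivariateGaussian hS (μ := 0),
    covarianceBilin_apply IsGaussian.memLp_two_id]
  simp

/-- The normalized coordinates of `x` in the eigenbasis given by the columns of `P`. -/
def eigenCoord {n : ℕ} (P : Matrix (Fin n) (Fin n) ℝ) (lam : Fin n → ℝ) (k : Fin n)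
    (x : EuclideanSpace ℝ (Fin n)) : ℝ :=
  (√(lam k))⁻¹ * (Pᵀ *ᵥ x.ofLp) k

section spectral

variable {n : ℕ} {S P : Matrix (Fin n) (Fin n) ℝ} {lam : Fin n → ℝ}

lemma transpose_mul_self_of_mem_orthogonalGroup (hP : P ∈ Matrix.orthogonalGroup (Fin n) ℝ) :
    Pᵀ * P = 1 := (Matrix.mem_orthogonalGroup_iff' (Fin n) ℝ).1 hP

lemma mul_transpose_self_of_mem_orthogonalGroup (hP : P ∈ Matrix.orthogonalGroup (Fin n) ℝ) :
    P * Pᵀ = 1 := (Matrix.mem_orthogonalGroup_iff (Fin n) ℝ).1 hP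

lemma transpose_mul_mul_eq_diagonal (hP : P ∈ Matrix.orthogonalGroup (Fin n) ℝ)
    (h : S = P * Matrix.diagonal lam * Pᵀ) : Pᵀ * S * P = Matrix.diagonal lam := by
  have hPP := transpose_mul_self_of_mem_orthogonalGroup hP
  rw [h, show Pᵀ * (P * Matrix.diagonal lam * Pᵀ) * P =
    (Pᵀ * P) * Matrix.diagonal lam * (Pᵀ * P) by simp only [Matrix.mul_assoc], hPP]
  simp

lemma eigenvalue_pos (hS : S.PosDef) (hP : P ∈ Matrix.orthogonalGroup (Fin n) ℝ)
    (h : S = P * Matrix.diagonal lam * Pᵀ) (k : Fin n) : 0 < lam k := by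
  have hinj : Function.Injective P.mulVec := fun x y hxy => by
    have := congrArg (Pᵀ *ᵥ ·) hxy
    simpa [transpose_mul_self_of_mem_orthogonalGroup hP] using this
  have h1 := hS.conjTranspose_mul_mul_same hinj
  rw [Matrix.conjTranspose_eq_transpose_of_trivial, transpose_mul_mul_eq_diagonal hP h] at h1
  exact Matrix.posDef_diagonal_iff.1 h1 k

lemma isOrthonormalL2_eigenCoord (hS : S.PosDef) (hP : P ∈ Matrix.orthogonalGroup (Fin n) ℝ)
    (h : S = P * Matrix.diagonal lam * Pᵀ) :
    IsOrthonormalL2 (multivariateGaussian 0 S) (eigenCoord P lam) := by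
  let e (k : Fin n) : EuclideanSpace ℝ (Fin n) := WithLp.toLp 2 (Pᵀ k)
  have he (k : Fin n) (x : EuclideanSpace ℝ (Fin n)) :
      eigenCoord P lam k x = (√(lam k))⁻¹ * inner ℝ (e k) x := by
    rw [euclidean_inner_eq_dotProduct]
    rfl
  refine ⟨fun k => ?_, fun k l => ?_⟩
  · have h2 : MemLp (fun x => inner ℝ (e k) x) 2 (multivariateGaussian 0 S) :=
      IsGaussian.memLp_two_id.const_inner (e k)
    simpa only [← he] using h2.const_mul (√(lam k))⁻¹
  · have hkl : (e k).ofLp ⬝ᵥ S *ᵥ (e l).ofLp = Matrix.diagonal lam k l := by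
      rw [← transpose_mul_mul_eq_diagonal hP h, Matrix.mul_assoc]
      rfl
    simp_rw [he, mul_mul_mul_comm]
    rw [integral_const_mul, integral_inner_mul_inner_multivariateGaussian hS.posSemidef, hkl]
    have hpos := eigenvalue_pos hS hP h k
    split_ifs with hk
    · subst hk
      rw [Matrix.diagonal_apply_eq, ← mul_inv, Real.mul_self_sqrt hpos.le,
        inv_mul_cancel₀ hpos.ne']
    · rw [Matrix.diagonal_apply_ne _ hk, mul_zero]

/-- The normalization by `√λ_k` cancels the eigenvalue, which is how the plain scalar product
acquires the covariance spectrum as its coefficients. -/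
lemma mul_eigenCoord_mul_eigenCoord {k : Fin n} (hk : 0 < lam k)
    (x y : EuclideanSpace ℝ (Fin n)) :
    lam k * (eigenCoord P lam k x * eigenCoord P lam k y) =
      (Pᵀ *ᵥ x.ofLp) k * (Pᵀ *ᵥ y.ofLp) k := by
  have h : lam k * ((√(lam k))⁻¹ * (√(lam k))⁻¹) = 1 := by
    rw [← mul_inv, Real.mul_self_sqrt hk.le, mul_inv_cancel₀ hk.ne']
  rw [eigenCoord, eigenCoord, mul_mul_mul_comm, ← mul_assoc, h, one_mul]

lemma dotProduct_orthogonal_mulVec (hP : Pᵀ * P = 1) (x y : Fin n → ℝ) :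
    (P *ᵥ x) ⬝ᵥ (P *ᵥ y) = x ⬝ᵥ y := by
  rw [Matrix.dotProduct_mulVec, ← Matrix.mulVec_transpose, Matrix.mulVec_mulVec, hP,
    Matrix.one_mulVec]

lemma isSpectral_gaussian (hS : S.PosDef) (hP : P ∈ Matrix.orthogonalGroup (Fin n) ℝ)
    (hlam : Antitone lam) (h : S = P * Matrix.diagonal lam * Pᵀ) :
    (GMSpace.gaussian S).IsSpectral lam (eigenCoord P lam) where
  antitone := hlam
  nonneg k := (eigenvalue_pos hS hP h k).le
  orthonormal := isOrthonormalL2_eigenCoord hS hP h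
  gauge_eq x x' := by
    change inner ℝ x x' = _
    have hPt : (Pᵀ)ᵀ * Pᵀ = 1 := by
      rw [Matrix.transpose_transpose, mul_transpose_self_of_mem_orthogonalGroup hP]
    rw [euclidean_inner_eq_dotProduct, ← dotProduct_orthogonal_mulVec hPt]
    exact Finset.sum_congr rfl fun k _ =>
      (mul_eigenCoord_mul_eigenCoord (eigenvalue_pos hS hP h k) x x').symm

end spectral

/-! ### Linear transports that are diagonal in the eigenbases -/

section diagonalTransport

lemma padCols_diagonal_mulVec {m n : ℕ} (h : m ≤ n) (c : Fin m → ℝ) (y : Fin n → ℝ) (k : Fin m) :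
    (padCols n (Matrix.diagonal c) *ᵥ y) k = c k * y (Fin.castLE h k) := by
  rw [Matrix.mulVec, dotProduct, Finset.sum_eq_single (Fin.castLE h k)]
  · simp [padCols]
  · intro l _ hl
    by_cases hlm : l.val < m
    · have : k ≠ ⟨l.val, hlm⟩ := by
        rintro rfl
        exact hl rfl
      simp [padCols, hlm, this]
    · simp [padCols, hlm]
  · simp

lemma padCols_diagonal_mul_diagonal_mul {m n : ℕ} (h : m ≤ n) (c : Fin m → ℝ) (lam : Fin n → ℝ) :
    padCols n (Matrix.diagonal c) * Matrix.diagonal lam * (padCols n (Matrix.diagonal c))ᵀ =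
      Matrix.diagonal fun k => c k ^ 2 * lam (Fin.castLE h k) := by
  ext k l
  change (padCols n (Matrix.diagonal c) * Matrix.diagonal lam) k ⬝ᵥ
    padCols n (Matrix.diagonal c) l = _
  rw [dotProduct_comm]
  change (padCols n (Matrix.diagonal c) *ᵥ _) l = _
  rw [padCols_diagonal_mulVec h, Matrix.mul_diagonal]
  by_cases hkl : k = l
  · subst hkl
    simp [padCols]
    ring
  · simp [padCols, hkl]

variable {m n : ℕ} {S P : Matrix (Fin n) (Fin n) ℝ} {Q : Matrix (Fin m) (Fin m) ℝ}
  {lam : Fin n → ℝ} {a c : Fin m → ℝ}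

lemma measurePreserving_diagonalTransport (h : m ≤ n) (hS : S.PosDef)
    (hP : P ∈ Matrix.orthogonalGroup (Fin n) ℝ) (hSP : S = P * Matrix.diagonal lam * Pᵀ)
    (hc : ∀ k, c k ^ 2 * lam (Fin.castLE h k) = a k) :
    MeasurePreserving (Matrix.toEuclideanLin (Q * padCols n (Matrix.diagonal c) * Pᵀ))
      (multivariateGaussian 0 S) (multivariateGaussian 0 (Q * Matrix.diagonal a * Qᵀ)) := by
  have := measurePreserving_toEuclideanLin_multivariateGaussian hS.posSemidef
    (Q * padCols n (Matrix.diagonal c) * Pᵀ)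
  convert this using 2
  have e := padCols_diagonal_mul_diagonal_mul h c lam
  simp_rw [hc, ← transpose_mul_mul_eq_diagonal hP hSP] at e
  rw [← e]
  simp only [Matrix.transpose_mul, Matrix.transpose_transpose, Matrix.mul_assoc]

/-- `Q` preserves scalar products, and the remaining diagonal factor contributes only through `c k ^
2`, so signs disappear. -/
lemma inner_diagonalTransport (h : m ≤ n) (hlam : ∀ k, 0 < lam k) (hQ : Qᵀ * Q = 1)
    (hc : ∀ k, c k ^ 2 * lam (Fin.castLE h k) = a k) (x x' : EuclideanSpace ℝ (Fin n)) :
    inner ℝ (Matrix.toEuclideanLin (Q * padCols n (Matrix.diagonal c) * Pᵀ) x)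
      (Matrix.toEuclideanLin (Q * padCols n (Matrix.diagonal c) * Pᵀ) x') =
      tensorKernel (fun k : Fin n => extendZero a k) (eigenCoord P lam) (x, x') := by
  -- Indexing by `ℕ` lets one summand serve both the sum over `Fin n` and the one over `Fin m`; the
  -- default 0 is never reached because `m ≤ n`.
  let f (r : ℝ) (k : ℕ) : ℝ := if hk : k < n then
    r * (eigenCoord P lam ⟨k, hk⟩ x * eigenCoord P lam ⟨k, hk⟩ x') else 0
  have hf : tensorKernel (fun k : Fin n => extendZero a k) (eigenCoord P lam) (x, x') =
      ∑ k : Fin n, f (extendZero a k) k := by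
    simp [f, tensorKernel]
  rw [hf, sum_fin_extendZero h a f (by simp [f]), euclidean_inner_eq_dotProduct,
    ofLp_toEuclideanLin, ofLp_toEuclideanLin, Matrix.mul_assoc, ← Matrix.mulVec_mulVec x.ofLp Q,
    ← Matrix.mulVec_mulVec x'.ofLp Q, dotProduct_orthogonal_mulVec hQ, dotProduct]
  refine Finset.sum_congr rfl fun k _ => ?_
  have hk : (k : ℕ) < n := k.2.trans_le h
  rw [← Matrix.mulVec_mulVec, ← Matrix.mulVec_mulVec, padCols_diagonal_mulVec h,
    padCols_diagonal_mulVec h, mul_mul_mul_comm,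
    ← mul_eigenCoord_mul_eigenCoord (hlam _), ← mul_assoc, ← sq, hc]
  simp only [f, hk, dif_pos]
  rfl

end diagonalTransport

lemma exists_transportMatrix_eq {m n : ℕ} (h : m ≤ n) {J : Matrix (Fin m) (Fin m) ℝ}
    (hJ : J ∈ signMatrices m) {lam : Fin m → ℝ} {lam₁ : Fin n → ℝ} (hlam : ∀ k, 0 < lam k)
    (hlam₁ : ∀ k, 0 < lam₁ k) :
    ∃ c : Fin m → ℝ, transportMatrix h J lam lam₁ = padCols n (Matrix.diagonal c) ∧
      ∀ k, c k ^ 2 * lam₁ (Fin.castLE h k) = lam k := by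
  obtain ⟨s, hs, rfl⟩ := hJ
  refine ⟨fun k => s k * √(lam k) * (√(lam₁ (Fin.castLE h k)))⁻¹, ?_, fun k => ?_⟩
  · rw [transportMatrix, Matrix.diagonal_mul_diagonal, Matrix.diagonal_mul_diagonal]
  · have h1 : s k ^ 2 = 1 := by rcases hs k with h | h <;> simp [h]
    rw [mul_pow, mul_pow, h1, inv_pow, Real.sq_sqrt (hlam k).le, Real.sq_sqrt (hlam₁ _).le,
      one_mul, mul_assoc, inv_mul_cancel₀ (hlam₁ _).ne', mul_one]

lemma sum_smul_padSquare_diagonal {N : ℕ} {d : Fin N → ℕ} (n : ℕ) (ρ : Fin N → ℝ)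
    (lam : ∀ i, Fin (d i) → ℝ) :
    ∑ i, ρ i • padSquare n (Matrix.diagonal (lam i)) =
      Matrix.diagonal fun k : Fin n => meanSpectrum ρ lam k := by
  ext k l
  rw [Matrix.sum_apply]
  by_cases hkl : k = l
  · subst hkl
    rw [Matrix.diagonal_apply_eq]
    refine Finset.sum_congr rfl fun i _ => ?_
    by_cases hk : k.val < d i <;> simp [padSquare, extendZero, hk]
  · rw [Matrix.diagonal_apply_ne _ hkl]
    refine Finset.sum_eq_zero fun i _ => ?_
    have : (k : ℕ) ≠ l := fun h => hkl (Fin.ext h)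
    by_cases hk : k.val < d i ∧ l.val < d i <;> simp [padSquare, hk, this]

end

theorem theorem5p2 {N : ℕ} [NeZero N] (d : Fin N → ℕ) (hd : Antitone d)
    (S : ∀ i, Matrix (Fin (d i)) (Fin (d i)) ℝ) (hS : ∀ i, (S i).PosDef)
    (P : ∀ i, Matrix (Fin (d i)) (Fin (d i)) ℝ)
    (hP : ∀ i, P i ∈ Matrix.orthogonalGroup (Fin (d i)) ℝ)
    (lam : ∀ i, Fin (d i) → ℝ) (hlam : ∀ i, Antitone (lam i))
    (hdiag : ∀ i, S i = P i * Matrix.diagonal (lam i) * (P i)ᵀ)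
    (J : ∀ i, Matrix (Fin (d i)) (Fin (d i)) ℝ) (hJ : ∀ i, J i ∈ signMatrices (d i))
    (T : ∀ i, EuclideanSpace ℝ (Fin (d 0)) → EuclideanSpace ℝ (Fin (d i)))
    (hT : ∀ i x, T i x = Matrix.toEuclideanLin
      (P i * transportMatrix (hd (Fin.zero_le i)) (J i) (lam i) (lam 0) * (P 0)ᵀ) x)
    (ρ : Fin N → ℝ) (hρ : ρ ∈ stdSimplex ℝ (Fin N)) :
    (multivariateGaussian 0 (S 0)).map (fun x i => T i x) ∈
        GMSpace.optimalMultiPlans ρ (fun i => GMSpace.gaussian (S i)) ∧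
      GMSpace.IsGWBarycenter.{u, 0, 0} ρ (fun i => GMSpace.gaussian (S i))
        (GMSpace.gaussian (∑ i, ρ i • padSquare (d 0) (Matrix.diagonal (lam i)))) := by
  have hM (i) : d i ≤ d 0 := hd (Fin.zero_le i)
  have hpos (i) := eigenvalue_pos (hS i) (hP i) (hdiag i)
  have hX (i) := isSpectral_gaussian (hS i) (hP i) (hlam i) (hdiag i)
  have hv := isOrthonormalL2_eigenCoord (hS 0) (hP 0) (hdiag 0)
  choose c hcT hc using fun i => exists_transportMatrix_eq (hM i) (hJ i) (hpos i) (hpos 0)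
  have hT' (i) : T i = Matrix.toEuclideanLin
      (P i * padCols (d 0) (Matrix.diagonal (c i)) * (P 0)ᵀ) :=
    funext fun x => by rw [hT, hcT]
  have hf (i) : MeasurePreserving (T i) (multivariateGaussian 0 (S 0))
      (GMSpace.gaussian (S i)).measure := by
    rw [hT' i]
    change MeasurePreserving _ _ (multivariateGaussian 0 (S i))
    rw [hdiag i]
    exact measurePreserving_diagonalTransport (hM i) (hS 0) (hP 0) (hdiag 0) (hc i)
  have hgauge (i) (x x' : EuclideanSpace ℝ (Fin (d 0))) :
      (GMSpace.gaussian (S i)).gauge (T i x) (T i x') =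
        tensorKernel (fun k : Fin (d 0) => extendZero (lam i) k)
          (eigenCoord (P 0) (lam 0)) (x, x') := by
    rw [hT' i]
    exact inner_diagonalTransport (hM i) (hpos 0)
      (transpose_mul_self_of_mem_orthogonalGroup (hP i)) (hc i) x x'
  refine ⟨?_, fun Z => ?_⟩
  · obtain ⟨hmem, hval⟩ := GMSpace.mgwFunctional_map_eq
      (X := fun i => GMSpace.gaussian (S i)) hρ hv hf hgauge
    exact ⟨hmem, fun σ hσ =>
      hval.trans_le (GMSpace.spectralVariance_le_mgwFunctional hM hρ hX hσ)⟩
  · let ν (k : Fin (d 0)) : ℝ := meanSpectrum ρ lam k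
    let b (k : Fin (d 0)) : ℝ := √(ν k) * (√(lam 0 k))⁻¹
    have hν (k) : 0 ≤ ν k := Finset.sum_nonneg fun i _ =>
      mul_nonneg (hρ.1 i) (extendZero_nonneg (fun l => (hpos i l).le) _)
    have hb (k : Fin (d 0)) : b k ^ 2 * lam 0 (Fin.castLE le_rfl k) = ν k := by
      change b k ^ 2 * lam 0 k = ν k
      rw [mul_pow, inv_pow, Real.sq_sqrt (hν k), Real.sq_sqrt (hpos 0 k).le, mul_assoc,
        inv_mul_cancel₀ (hpos 0 k).ne', mul_one]
    have hg := measurePreserving_diagonalTransport (Q := 1) le_rfl (hS 0) (hP 0) (hdiag 0) hb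
    rw [Matrix.transpose_one, Matrix.mul_one, Matrix.one_mul (Matrix.diagonal _),
      ← sum_smul_padSquare_diagonal (d 0) ρ lam] at hg
    refine (GMSpace.barycenterLoss_le (X := fun i => GMSpace.gaussian (S i)) hρ hv hf hgauge hg
      fun x x' => ?_).trans (GMSpace.spectralVariance_le_barycenterLoss hM hρ hX Z)
    refine (inner_diagonalTransport (Q := 1) le_rfl (hpos 0) (by simp) hb x x').trans ?_
    simp_rw [extendZero_val]
    rfl
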